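/- Let $\Gamma$ be a finite distance-regular graph with valency $k$, diameter $D\ge 3$ and smallest adjacency eigenvalue $\theta_{\min}$ (so $\Gamma$ is connected and, for vertices $x,y$ at distance $i$, the number of neighbours of $y$ at distance $i-1$, respectively $i+1$, from $x$ depends only on $i$). A clique of $\Gamma$ is called a Delsarte clique if it has exactly $1+\frac{k}{-\theta_{\min}}$ vertices. For a vertex $x$ and a set $T$ of vertices put $d(x,T)=\min\{d(x,y)\mid y\in T\}$. It is known that, for a Delsarte clique $C$ and a vertex $x$ with $d(x,C)=1$, the number of vertices of $C$ adjacent to $x$ is a constant $\phi_1$, independent of $x$ and $C$. Assume that $\Gamma$ is geometric with respect to a set $\mathcal C$ of Delsarte cliques, that is, every edge of $\Gamma$ lies in a unique member of $\mathcal C$; call the members of $\mathcal C$ lines. For vertices $x,y$ at distance $2$ let $[x,y]$ be the set of lines $\ell$ containing $x$ with $d(y,\ell)=1$. Assume that $\phi_1\ge 2$ and that $\Gamma$ has the equal line set (ELS) property: for every vertex $x$ and every line $\ell$ with $d(x,\ell)=1$, and for every two distinct vertices $y_1,y_2$ on $\ell$ at distance $2$ from $x$, we have $[x,y_1]=[x,y_2]$.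 Then $\Gamma$ satisfies the dual Pasch axiom: for every two adjacent vertices $x,y$, the set of common neighbours of $x$ and $y$ that do not lie on the line through $x$ and $y$ is a clique. -/

import Mathlib

namespace GeometricDRG

/-- A connected graph is *distance-regular* if there are integers `b i`, `c i` such that for any
two vertices `x`, `y` at distance `i`, the vertex `y` has exactly `c i` neighbours at distance
`i - 1` from `x`, and exactly `b i` neighbours at distance `i + 1` from `x`. -/
def IsDistanceRegular {V : Type*} (G : SimpleGraph V) : Prop :=
  G.Connected ∧ ∃ b c : ℕ → ℕ, ∀ x y : V,
    {z | G.Adj y z ∧ G.dist x z + 1 = G.dist x y}.ncard = c (G.dist x y) ∧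
    {z | G.Adj y z ∧ G.dist x z = G.dist x y + 1}.ncard = b (G.dist x y)

/-- The smallest eigenvalue of the adjacency matrix of a finite graph (the set of real eigenvalues
is finite, and it is nonempty as soon as the graph has a vertex, so that the infimum is
a minimum). -/
noncomputable def smallestEigenvalue {V : Type*} [Fintype V] [DecidableEq V]
    (G : SimpleGraph V) [DecidableRel G.Adj] : ℝ :=
  sInf {θ : ℝ | Module.End.HasEigenvalue (Matrix.toLin' (G.adjMatrix ℝ)) θ}

/-- A *Delsarte clique* of a regular graph of valency `k` is a clique of order
`1 + k / (-θ)`, where `θ` is the smallest eigenvalue. -/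
def IsDelsarteClique {V : Type*} [Fintype V] [DecidableEq V]
    (G : SimpleGraph V) [DecidableRel G.Adj] (C : Finset V) : Prop :=
  G.IsClique (C : Set V) ∧
    ∃ k : ℕ, G.IsRegularOfDegree k ∧ (C.card : ℝ) = 1 + (k : ℝ) / (-smallestEigenvalue G)

/-- `G` is a geometric distance-regular graph with respect to the set `𝒞` of cliques: `G` is
distance-regular, the members of `𝒞` are Delsarte cliques, and every edge lies in a unique
member of `𝒞`. The members of `𝒞` are called *lines*. -/
def IsGeometric {V : Type*} [Fintype V] [DecidableEq V]
    (G : SimpleGraph V) [DecidableRel G.Adj] (𝒞 : Set (Finset V)) : Prop :=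
  IsDistanceRegular G ∧ (∀ C ∈ 𝒞, IsDelsarteClique G C) ∧
    ∀ x y : V, G.Adj x y → ∃! C : Finset V, C ∈ 𝒞 ∧ x ∈ C ∧ y ∈ C

/-- The distance `min {d(x, y) | y ∈ T}` of a vertex `x` to a (nonempty) set `T` of vertices. -/
noncomputable def distTo {V : Type*} (G : SimpleGraph V) (x : V) (T : Finset V) : ℕ :=
  sInf (G.dist x '' (T : Set V))

/-- The parameter `φ_j`: the number of vertices of `C` at distance `j` from `x`, where `C` is a
Delsarte clique and `x` a vertex at distance `j` from `C`. In a distance-regular graph this number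
is the same for all such pairs `(x, C)`, so that the supremum below is that common value. (If the
supremum is at least `m ≥ 1`, this says no more than that some such pair has a number `≥ m`.) -/
noncomputable def phi {V : Type*} [Fintype V] [DecidableEq V]
    (G : SimpleGraph V) [DecidableRel G.Adj] (j : ℕ) : ℕ :=
  sSup {n : ℕ | ∃ (C : Finset V) (x : V), IsDelsarteClique G C ∧ distTo G x C = j ∧
    n = {y | y ∈ C ∧ G.dist x y = j}.ncard}

/-- For vertices `x`, `y` at distance `2`, the set `[x, y]` of the lines that contain `x` and are at
distance `1` from `y`. -/
def linesBetween {V : Type*} (G : SimpleGraph V) (𝒞 : Set (Finset V)) (x y : V) :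
    Set (Finset V) :=
  {l | l ∈ 𝒞 ∧ x ∈ l ∧ distTo G y l = 1}

/-- The *equal line set property*: if the vertex `x` is at distance `1` from the line `l`, and
`y₁ ≠ y₂` are vertices on `l` at distance `2` from `x`, then `[x, y₁] = [x, y₂]`. -/
def EqualLineSet {V : Type*} (G : SimpleGraph V) (𝒞 : Set (Finset V)) : Prop :=
  ∀ (x : V), ∀ l ∈ 𝒞, distTo G x l = 1 →
    ∀ y₁ ∈ l, ∀ y₂ ∈ l, y₁ ≠ y₂ → G.dist x y₁ = 2 → G.dist x y₂ = 2 →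
      linesBetween G 𝒞 x y₁ = linesBetween G 𝒞 x y₂

/-- The *dual Pasch axiom*, for the point graph `G` of a partial linear space with set of
lines `𝒞`: for adjacent `x`, `y`, the common neighbours of `x` and `y` outside the line `l` through
`x` and `y` form a clique. -/
def DualPasch {V : Type*} (G : SimpleGraph V) (𝒞 : Set (Finset V)) : Prop :=
  ∀ x y : V, G.Adj x y → ∃ l ∈ 𝒞, x ∈ l ∧ y ∈ l ∧
    G.IsClique {z | G.Adj x z ∧ G.Adj y z ∧ z ∉ l}

end GeometricDRG

namespace GeometricDRG

/-- The vertex `a` lies on `l` or is adjacent to a vertex of `l`. -/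
def Near {V : Type*} (G : SimpleGraph V) (a : V) (l : Finset V) : Prop :=
  ∃ p ∈ l, a = p ∨ G.Adj a p

/-- Every vertex of each of the two sets is near the other set. -/
def Related {V : Type*} (G : SimpleGraph V) (l m : Finset V) : Prop :=
  (∀ a ∈ l, Near G a m) ∧ ∀ a ∈ m, Near G a l

/-- The combinatorial properties of the lines of a geometric distance-regular graph with the
equal line set property that are used in the proof of the dual Pasch axiom. -/
structure IsLineSystem {V : Type*} (G : SimpleGraph V) [DecidableRel G.Adj]
    (𝒞 : Set (Finset V)) (φ : ℕ) : Prop where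
  clique : ∀ l ∈ 𝒞, G.IsClique (l : Set V)
  exists_line : ∀ x y, G.Adj x y → ∃ l ∈ 𝒞, x ∈ l ∧ y ∈ l
  eq_of_mem : ∀ l ∈ 𝒞, ∀ m ∈ 𝒞, ∀ x y, x ≠ y → x ∈ l → y ∈ l → x ∈ m → y ∈ m → l = m
  card_filter : ∀ l ∈ 𝒞, ∀ x ∉ l, Near G x l → (l.filter (G.Adj x)).card = φ
  two_le : 2 ≤ φ
  two_mul_le : ∀ l ∈ 𝒞, 2 * φ ≤ l.card
  related : ∀ l ∈ 𝒞, ∀ m ∈ 𝒞, ∀ x ∈ l, ∀ y ∈ m, x ≠ y → ¬ G.Adj x y →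
    Near G x m → Near G y l → Related G l m
  exists_not_near : ∀ x u, x ≠ u → ¬ G.Adj x u → (∃ p, G.Adj x p ∧ G.Adj p u) →
    ∃ n ∈ 𝒞, x ∈ n ∧ ¬ Near G u n

variable {V : Type*} {G : SimpleGraph V} {𝒞 : Set (Finset V)} {φ : ℕ} {l m : Finset V} {a p x : V}

lemma near_of_mem (h : a ∈ l) : Near G a l := ⟨a, h, .inl rfl⟩

lemma near_of_adj (h : G.Adj a p) (hp : p ∈ l) : Near G a l := ⟨p, hp, .inr h⟩

/-- A vertex of a clique is near every set that meets the clique. -/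
lemma near_of_clique_mem (hl : G.IsClique (l : Set V)) (ha : a ∈ l) (hx : x ∈ l) (hm : x ∈ m) :
    Near G a m := by
  by_cases h : a = x
  · exact near_of_mem (h ▸ hm)
  · exact near_of_adj (hl ha hx h) hm

namespace IsLineSystem

variable [DecidableRel G.Adj] {m' n q₁ q₂ r : Finset V} {z e z' : V}

lemma adj (h : IsLineSystem G 𝒞 φ) (hl : l ∈ 𝒞) (ha : a ∈ l) (hx : x ∈ l) (hne : a ≠ x) :
    G.Adj a x := h.clique l hl ha hx hne

lemma related_of_mem (h : IsLineSystem G 𝒞 φ) (hl : l ∈ 𝒞) (hm : m ∈ 𝒞) (hxl : x ∈ l)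
    (hxm : x ∈ m) : Related G l m :=
  ⟨fun _ ha => near_of_clique_mem (h.clique l hl) ha hxl hxm,
    fun _ ha => near_of_clique_mem (h.clique m hm) ha hxm hxl⟩

/-- If `l` and `m` are not related, two vertices of `l` near `m` have the same neighbours
on `m`. -/
lemma adj_of_not_related (h : IsLineSystem G 𝒞 φ) (hl : l ∈ 𝒞) (hm : m ∈ 𝒞)
    (hlm : ¬ Related G l m) (hz : z ∈ l) (he : e ∈ l) (hem : Near G e m) {v : V} (hv : v ∈ m)
    (hzv : G.Adj z v) : G.Adj e v := by
  by_contra hev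
  refine hlm (h.related l hl m hm e he v hv ?_ hev hem (near_of_adj hzv.symm hz))
  rintro rfl
  exact hlm (h.related_of_mem hl hm he hv)

lemma not_near_of_adj (h : IsLineSystem G 𝒞 φ) (hm' : m' ∈ 𝒞) (hn : n ∈ 𝒞)
    (hxm' : x ∈ m') (hxn : x ∈ n) (hz'm' : z' ∈ m')
    (hq₂ : q₂ ∈ 𝒞) (hz'q₂ : z' ∈ q₂) (hq₂m : Related G q₂ m)
    (hq₂n : ¬ Related G q₂ n) (hz : z ∈ m) (he : e ∈ n) (hzz : z ≠ z') (hzz' : ¬ G.Adj z z')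
    (hez : e ≠ z') (hez' : ¬ G.Adj e z') (hr : r ∈ 𝒞) (hzr : z ∈ r) (her : e ∈ r) :
    ¬ Near G z' r := by
  intro hnear
  have h1 : Related G q₂ r := h.related q₂ hq₂ r hr z' hz'q₂ z hzr hzz.symm
    (fun t => hzz' t.symm) hnear (hq₂m.2 z hz)
  exact hq₂n (h.related q₂ hq₂ n hn z' hz'q₂ e he hez.symm (fun t => hez' t.symm)
    (near_of_clique_mem (h.clique m' hm') hz'm' hxm' hxn) (h1.2 e her))

lemma adj_iff_of_adj (h : IsLineSystem G 𝒞 φ) (hr : r ∈ 𝒞) (hl : l ∈ 𝒞) (hz'l : z' ∈ l)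
    (hnear : ¬ Near G z' r) (hzr : z ∈ r) (her : e ∈ r) (hzl : Near G z l) (hel : Near G e l)
    {v : V} (hv : v ∈ l) : G.Adj z v ↔ G.Adj e v := by
  have hrl : ¬ Related G r l := fun t => hnear (t.2 z' hz'l)
  exact ⟨h.adj_of_not_related hr hl hrl hzr her hel hv,
    h.adj_of_not_related hr hl hrl her hzr hzl hv⟩

end IsLineSystem
end GeometricDRG

namespace GeometricDRG

variable {V : Type*} {G : SimpleGraph V} {𝒞 : Set (Finset V)} {φ : ℕ}

/-- A hypothetical failure of the local linear space axiom at `x`: the lines `q₁`, `q₂` through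
`z' ∈ m'` are both related to the line `m` through `x`, but only `q₁` is related to the line `n`
through `x`. -/
structure BadConfig (G : SimpleGraph V) (𝒞 : Set (Finset V)) (x z' : V)
    (m n m' q₁ q₂ : Finset V) : Prop where
  hm : m ∈ 𝒞
  hn : n ∈ 𝒞
  hm' : m' ∈ 𝒞
  hq₁ : q₁ ∈ 𝒞
  hq₂ : q₂ ∈ 𝒞
  xm : x ∈ m
  xn : x ∈ n
  xm' : x ∈ m'
  xq₁ : x ∉ q₁
  ne_mm' : m ≠ m'
  ne_mn : m ≠ n
  ne_nm' : n ≠ m'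
  z'm' : z' ∈ m'
  z'x : z' ≠ x
  z'q₁ : z' ∈ q₁
  z'q₂ : z' ∈ q₂
  rel₁m : Related G q₁ m
  rel₁n : Related G q₁ n
  rel₂m : Related G q₂ m
  rel₂n : ¬ Related G q₂ n

namespace BadConfig

variable [DecidableRel G.Adj] {m m' n q₁ q₂ r : Finset V} {x y z z₀ e z' v : V}

lemma z'_notMem_m (h : IsLineSystem G 𝒞 φ) (c : BadConfig G 𝒞 x z' m n m' q₁ q₂) : z' ∉ m :=
  fun hz => c.ne_mm' (h.eq_of_mem m c.hm m' c.hm' z' x c.z'x hz c.xm c.z'm' c.xm')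

lemma z'_notMem_n (h : IsLineSystem G 𝒞 φ) (c : BadConfig G 𝒞 x z' m n m' q₁ q₂) : z' ∉ n :=
  fun hz => c.ne_nm' (h.eq_of_mem n c.hn m' c.hm' z' x c.z'x hz c.xn c.z'm' c.xm')

lemma adj_z'_x (h : IsLineSystem G 𝒞 φ) (c : BadConfig G 𝒞 x z' m n m' q₁ q₂) : G.Adj z' x :=
  h.adj c.hm' c.z'm' c.xm' c.z'x

lemma not_near (h : IsLineSystem G 𝒞 φ) (c : BadConfig G 𝒞 x z' m n m' q₁ q₂)
    (hz : z ∈ m) (he : e ∈ n) (hzz' : ¬ G.Adj z z') (hez' : ¬ G.Adj e z')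
    (hr : r ∈ 𝒞) (hzr : z ∈ r) (her : e ∈ r) : ¬ Near G z' r :=
  h.not_near_of_adj c.hm' c.hn c.xm' c.xn c.z'm' c.hq₂ c.z'q₂ c.rel₂m c.rel₂n hz he
    (fun t => c.z'_notMem_m h (t ▸ hz)) hzz' (fun t => c.z'_notMem_n h (t ▸ he)) hez' hr hzr her

lemma adj_iff_m' (h : IsLineSystem G 𝒞 φ) (c : BadConfig G 𝒞 x z' m n m' q₁ q₂)
    (hz : z ∈ m) (he : e ∈ n) (hzz' : ¬ G.Adj z z') (hez' : ¬ G.Adj e z') (hze : G.Adj z e)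
    (hv : v ∈ m') : G.Adj z v ↔ G.Adj e v := by
  obtain ⟨r, hr, hzr, her⟩ := h.exists_line z e hze
  exact h.adj_iff_of_adj hr c.hm' c.z'm' (c.not_near h hz he hzz' hez' hr hzr her) hzr her
    (near_of_clique_mem (h.clique m c.hm) hz c.xm c.xm')
    (near_of_clique_mem (h.clique n c.hn) he c.xn c.xm') hv

lemma adj_iff_q₁ (h : IsLineSystem G 𝒞 φ) (c : BadConfig G 𝒞 x z' m n m' q₁ q₂)
    (hz : z ∈ m) (he : e ∈ n) (hzz' : ¬ G.Adj z z') (hez' : ¬ G.Adj e z') (hze : G.Adj z e)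
    (hv : v ∈ q₁) : G.Adj z v ↔ G.Adj e v := by
  obtain ⟨r, hr, hzr, her⟩ := h.exists_line z e hze
  exact h.adj_iff_of_adj hr c.hq₁ c.z'q₁ (c.not_near h hz he hzz' hez' hr hzr her) hzr her
    (c.rel₁m.2 z hz) (c.rel₁n.2 e he) hv

/-- A bad configuration at `z' ∈ m'` yields one at a vertex `e ∈ n`. -/
lemma transfer (h : IsLineSystem G 𝒞 φ) (c : BadConfig G 𝒞 x z' m n m' q₁ q₂)
    (hz : z ∈ m) (he : e ∈ n) (hzz' : ¬ G.Adj z z') (hez' : ¬ G.Adj e z') (hze : G.Adj z e)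
    (hy : y ∈ q₁) (hye : G.Adj y e) (hyx : ¬ G.Adj y x) :
    ∃ o ∈ 𝒞, y ∈ o ∧ ∃ r, BadConfig G 𝒞 x e m m' n o r := by
  obtain ⟨r, hr, hzr, her⟩ := h.exists_line z e hze
  obtain ⟨o, ho, hyo, heo⟩ := h.exists_line y e hye
  have hex : e ≠ x := fun t => hez' (t ▸ (c.adj_z'_x h).symm)
  have hne : y ≠ x := fun t => c.xq₁ (t ▸ hy)
  have hxo : Near G x o := near_of_adj (h.adj c.hn c.xn he hex.symm) heo
  refine ⟨o, ho, hyo, r, c.hm, c.hm', c.hn, ho, hr, c.xm, c.xm', c.xn, ?_, c.ne_mn, c.ne_mm',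
    c.ne_nm'.symm, he, hex, heo, her, ?_, ?_, h.related_of_mem hr c.hm hzr hz, ?_⟩
  · exact fun hx => hyx (h.adj ho hyo hx hne)
  · exact h.related o ho m c.hm y hyo x c.xm hne hyx (c.rel₁m.1 y hy) hxo
  · exact h.related o ho m' c.hm' y hyo x c.xm' hne hyx
      (near_of_clique_mem (h.clique _ c.hq₁) hy c.z'q₁ c.z'm') hxo
  · exact fun hrm => c.not_near h hz he hzz' hez' hr hzr her (hrm.2 z' c.z'm')

lemma exists_transfer_vertex (h : IsLineSystem G 𝒞 φ) (c : BadConfig G 𝒞 x z' m n m' q₁ q₂)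
    (he : e ∈ n) (hez' : ¬ G.Adj e z') : ∃ y ∈ q₁, G.Adj y e ∧ ¬ G.Adj y x := by
  by_contra! hcon
  have hne : e ≠ z' := fun t => c.z'_notMem_n h (t ▸ he)
  have heq : e ∉ q₁ := fun t => hez' (h.adj c.hq₁ t c.z'q₁ hne)
  have hx : Near G x q₁ := near_of_adj (c.adj_z'_x h).symm c.z'q₁
  have hlt : (q₁.filter (G.Adj e)) ⊂ q₁.filter (G.Adj x) := by
    refine Finset.ssubset_iff_subset_ne.2 ⟨fun y hy => ?_, fun t => ?_⟩
    · rw [Finset.mem_filter] at hy ⊢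
      exact ⟨hy.1, (hcon y hy.1 hy.2.symm).symm⟩
    · have : z' ∈ q₁.filter (G.Adj x) :=
        Finset.mem_filter.2 ⟨c.z'q₁, (c.adj_z'_x h).symm⟩
      rw [← t, Finset.mem_filter] at this
      exact hez' this.2
  have := Finset.card_lt_card hlt
  rw [h.card_filter _ c.hq₁ e heq (c.rel₁n.2 e he), h.card_filter _ c.hq₁ x c.xq₁ hx] at this
  exact lt_irrefl _ this

lemma exists_adj_m (h : IsLineSystem G 𝒞 φ) (c : BadConfig G 𝒞 x z' m n m' q₁ q₂)
    (he : e ∈ n) (hez' : ¬ G.Adj e z') (hz₀ : z₀ ∈ m) (hz₀z' : G.Adj z₀ z')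
    (hez₀ : ¬ G.Adj e z₀) : ∃ z ∈ m, G.Adj z e ∧ ¬ G.Adj z z' := by
  by_contra! hcon
  have hex : e ≠ x := fun t => hez' (t ▸ (c.adj_z'_x h).symm)
  have hem : e ∉ m := fun t => c.ne_mn (h.eq_of_mem m c.hm n c.hn e x hex t c.xm he c.xn)
  have hlt : (m.filter (G.Adj e)) ⊂ m.filter (G.Adj z') := by
    refine Finset.ssubset_iff_subset_ne.2 ⟨fun y hy => ?_, fun t => ?_⟩
    · rw [Finset.mem_filter] at hy ⊢
      exact ⟨hy.1, (hcon y hy.1 hy.2.symm).symm⟩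
    · have : z₀ ∈ m.filter (G.Adj z') := Finset.mem_filter.2 ⟨hz₀, hz₀z'.symm⟩
      rw [← t, Finset.mem_filter] at this
      exact hez₀ this.2
  have := Finset.card_lt_card hlt
  rw [h.card_filter _ c.hm e hem (near_of_clique_mem (h.clique n c.hn) he c.xn c.xm),
    h.card_filter _ c.hm z' (c.z'_notMem_m h) (near_of_adj (c.adj_z'_x h) c.xm)] at this
  exact lt_irrefl _ this

/-- The consequences of a bad configuration for a vertex `z₀ ∈ m` adjacent to `z'` and a vertex
`e ∈ n` adjacent to neither of them. -/
lemma of_not_adj (h : IsLineSystem G 𝒞 φ) (c : BadConfig G 𝒞 x z' m n m' q₁ q₂)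
    (he : e ∈ n) (hez' : ¬ G.Adj e z') (hz₀ : z₀ ∈ m) (hz₀z' : G.Adj z₀ z')
    (hez₀ : ¬ G.Adj e z₀) :
    (∀ v ∈ n, G.Adj z₀ v ↔ G.Adj z' v) ∧
    (∀ y ∈ q₁, G.Adj y e → ¬ G.Adj y x → (G.Adj z₀ y ↔ G.Adj z' y)) ∧ z₀ ∉ q₁ := by
  obtain ⟨z, hz, hze, hzz'⟩ := c.exists_adj_m h he hez' hz₀ hz₀z' hez₀
  obtain ⟨y, hy, hye, hyx⟩ := c.exists_transfer_vertex h he hez'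
  obtain ⟨o, ho, hyo, r, d⟩ := c.transfer h hz he hzz' hez' hze hy hye hyx
  refine ⟨fun v hv => d.adj_iff_m' h hz₀ c.z'm' (fun t => hez₀ t.symm) (fun t => hez' t.symm)
    hz₀z' hv, fun y hy hye hyx => ?_, fun hz₀q => ?_⟩
  · obtain ⟨o, ho, hyo, r, d⟩ := c.transfer h hz he hzz' hez' hze hy hye hyx
    exact d.adj_iff_q₁ h hz₀ c.z'm' (fun t => hez₀ t.symm) (fun t => hez' t.symm) hz₀z' hyo
  · exact d.not_near h hz₀ c.z'm' (fun t => hez₀ t.symm) (fun t => hez' t.symm) c.hq₁ hz₀q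
      c.z'q₁ (c.rel₁n.2 e he)

lemma false (h : IsLineSystem G 𝒞 φ) (c : BadConfig G 𝒞 x z' m n m' q₁ q₂) : False := by
  classical
  have h2 := h.two_le
  have hz'x := c.adj_z'_x h
  have hM := h.card_filter m c.hm z' (c.z'_notMem_m h) (near_of_adj hz'x c.xm)
  have hN := h.card_filter n c.hn z' (c.z'_notMem_n h) (near_of_adj hz'x c.xn)
  have hX := h.card_filter q₁ c.hq₁ x c.xq₁ (near_of_adj hz'x.symm c.z'q₁)
  obtain ⟨z₀, hz₀, hz₀x⟩ := Finset.exists_mem_ne (by omega : 1 < (m.filter (G.Adj z')).card) x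
  rw [Finset.mem_filter] at hz₀
  obtain ⟨hz₀, hz₀z'⟩ := hz₀
  have hz₀n : z₀ ∉ n := fun t => c.ne_mn (h.eq_of_mem m c.hm n c.hn z₀ x hz₀x hz₀ c.xm t c.xn)
  have hZ := h.card_filter n c.hn z₀ hz₀n (near_of_clique_mem (h.clique m c.hm) hz₀ c.xm c.xn)
  have hncard := h.two_mul_le n c.hn
  -- a vertex of `n` adjacent to neither `z'` nor `z₀`
  obtain ⟨e, he, hez', hez₀⟩ : ∃ e ∈ n, ¬ G.Adj e z' ∧ ¬ G.Adj e z₀ := by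
    by_contra! hcon
    have hsub : n ⊆ n.filter (G.Adj z') ∪ (n.filter (G.Adj z₀)).erase x := by
      intro e he
      by_cases hez : G.Adj e z'
      · exact Finset.mem_union_left _ (Finset.mem_filter.2 ⟨he, hez.symm⟩)
      · refine Finset.mem_union_right _ (Finset.mem_erase.2 ⟨?_,
          Finset.mem_filter.2 ⟨he, (hcon e he hez).symm⟩⟩)
        exact fun t => hez (t ▸ hz'x.symm)
    have h1 := (Finset.card_le_card hsub).trans (Finset.card_union_le _ _)
    rw [Finset.card_erase_of_mem
      (Finset.mem_filter.2 ⟨c.xn, h.adj c.hm hz₀ c.xm hz₀x⟩)] at h1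
    omega
  obtain ⟨h1, -, hz₀q⟩ := c.of_not_adj h he hez' hz₀ hz₀z'.symm hez₀
  have hY := h.card_filter q₁ c.hq₁ z₀ hz₀q (near_of_adj hz₀z'.symm c.z'q₁)
  have hqcard := h.two_mul_le q₁ c.hq₁
  obtain ⟨y, hy, hyx, hyz₀⟩ : ∃ y ∈ q₁, ¬ G.Adj y x ∧ ¬ G.Adj y z₀ := by
    by_contra! hcon
    have hsub : q₁ ⊆ q₁.filter (G.Adj x) ∪ (q₁.filter (G.Adj z₀)).erase z' := by
      intro e he
      by_cases hez : G.Adj e x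
      · exact Finset.mem_union_left _ (Finset.mem_filter.2 ⟨he, hez.symm⟩)
      · refine Finset.mem_union_right _ (Finset.mem_erase.2 ⟨?_,
          Finset.mem_filter.2 ⟨he, (hcon e he hez).symm⟩⟩)
        exact fun t => hez (t ▸ hz'x)
    have h1 := (Finset.card_le_card hsub).trans (Finset.card_union_le _ _)
    rw [Finset.card_erase_of_mem (Finset.mem_filter.2 ⟨c.z'q₁, hz₀z'.symm⟩)] at h1
    omega
  have hyne : y ≠ x := fun t => c.xq₁ (t ▸ hy)
  have hyn : y ∉ n := fun t => hyx (h.adj c.hn t c.xn hyne)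
  have hYn := h.card_filter n c.hn y hyn (c.rel₁n.1 y hy)
  obtain ⟨e', he', hye', hez''⟩ : ∃ e ∈ n, G.Adj y e ∧ ¬ G.Adj e z' := by
    by_contra! hcon
    have hlt : (n.filter (G.Adj y)) ⊂ n.filter (G.Adj z') := by
      refine Finset.ssubset_iff_subset_ne.2 ⟨fun v hv => ?_, fun t => ?_⟩
      · rw [Finset.mem_filter] at hv ⊢
        exact ⟨hv.1, (hcon v hv.1 hv.2).symm⟩
      · have : x ∈ n.filter (G.Adj z') := Finset.mem_filter.2 ⟨c.xn, hz'x⟩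
        rw [← t, Finset.mem_filter] at this
        exact hyx this.2
    have := Finset.card_lt_card hlt
    omega
  have hez₀' : ¬ G.Adj e' z₀ := fun t => hez'' ((h1 e' he').1 t.symm).symm
  obtain ⟨-, h3, -⟩ := c.of_not_adj h he' hez'' hz₀ hz₀z'.symm hez₀'
  refine hyz₀ ((h3 y hy hye' hyx).2 (h.adj c.hq₁ c.z'q₁ hy ?_)).symm
  exact fun t => hyx (t ▸ hz'x)

end BadConfig

namespace IsLineSystem

variable [DecidableRel G.Adj] {m m' n q₁ q₂ : Finset V} {x z' : V}

/-- Two lines through `x` determine the block of lines through `x` that contains them. -/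
lemma related_of_related (h : IsLineSystem G 𝒞 φ) (hm : m ∈ 𝒞) (hn : n ∈ 𝒞) (hm' : m' ∈ 𝒞)
    (hq₁ : q₁ ∈ 𝒞) (hq₂ : q₂ ∈ 𝒞) (xm : x ∈ m) (xn : x ∈ n) (xm' : x ∈ m') (xq₁ : x ∉ q₁)
    (hmm' : m ≠ m') (z'm' : z' ∈ m') (z'q₁ : z' ∈ q₁) (z'q₂ : z' ∈ q₂)
    (rel₁m : Related G q₁ m) (rel₁n : Related G q₁ n) (rel₂m : Related G q₂ m) :
    Related G q₂ n := by
  by_contra hc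
  refine BadConfig.false h (x := x) (z' := z') (m := m) (n := n) (m' := m') (q₁ := q₁) (q₂ := q₂)
    ⟨hm, hn, hm', hq₁, hq₂, xm, xn, xm', xq₁, hmm', ?_, ?_, z'm', ?_, z'q₁, z'q₂, rel₁m, rel₁n,
      rel₂m, hc⟩
  · rintro rfl
    exact hc rel₂m
  · rintro rfl
    exact hc (h.related_of_mem hq₂ hn z'q₂ z'm')
  · rintro rfl
    exact xq₁ z'q₁

theorem dualPasch (h : IsLineSystem G 𝒞 φ) : DualPasch G 𝒞 := by
  intro x y hxy
  obtain ⟨l, hl, hxl, hyl⟩ := h.exists_line x y hxy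
  refine ⟨l, hl, hxl, hyl, ?_⟩
  rintro z ⟨hxz, hyz, hzl⟩ z' ⟨hxz', hyz', hz'l⟩ hne
  by_contra hzz'
  obtain ⟨m, hm, hxm, hzm⟩ := h.exists_line x z hxz
  obtain ⟨m', hm', hxm', hzm'⟩ := h.exists_line x z' hxz'
  obtain ⟨p, hp, hyp, hzp⟩ := h.exists_line y z hyz
  obtain ⟨p', hp', hyp', hzp'⟩ := h.exists_line y z' hyz'
  have hml : m ≠ l := fun t => hzl (t ▸ hzm)
  have hmm' : m' ≠ m := fun t => hzz' (h.adj hm hzm (t ▸ hzm') hne)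
  have hxp : x ∉ p := fun t => hzl (h.eq_of_mem p hp l hl x y hxy.ne t hyp hxl hyl ▸ hzp)
  have hxp' : x ∉ p' := fun t => hz'l (h.eq_of_mem p' hp' l hl x y hxy.ne t hyp' hxl hyl ▸ hzp')
  have hpm' : Related G p m' := h.related p hp m' hm' z hzp z' hzm' hne hzz'
    (near_of_adj hxz.symm hxm') (near_of_adj hyz'.symm hyp)
  have hp'm : Related G p' m := h.related p' hp' m hm z' hzp' z hzm hne.symm
    (fun t => hzz' t.symm) (near_of_adj hxz'.symm hxm) (near_of_adj hyz.symm hyp')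
  have hpm : Related G p m := h.related_of_mem hp hm hzp hzm
  -- a line `n` through `x` outside the block
  obtain ⟨u, hu, hxu⟩ : ∃ u ∈ p, ¬ G.Adj x u := by
    by_contra! hcon
    have h1 := h.card_filter p hp x hxp (near_of_adj hxy hyp)
    rw [Finset.filter_true_of_mem hcon] at h1
    have h2 := h.two_mul_le p hp
    have := h.two_le
    omega
  have hxune : x ≠ u := fun t => hxp (t ▸ hu)
  have hyu : y ≠ u := fun t => hxu (t ▸ hxy)
  obtain ⟨n, hn, hxn, hun⟩ := h.exists_not_near x u hxune hxu ⟨y, hxy, h.adj hp hyp hu hyu⟩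
  have hpn : ¬ Related G p n := fun t => hun (t.1 u hu)
  have hp'n : ¬ Related G p' n := fun t => hpn <|
    h.related_of_related hm hn hl hp' hp hxm hxn hxl hxp' hml hyl hyp' hyp hp'm t hpm
  have hyn : y ∉ n := fun t => hpn (h.related_of_mem hp hn hyp t)
  have hzn : z ∉ n := fun t => hpn (h.related_of_mem hp hn hzp t)
  have hzn' : z' ∉ n := fun t => hp'n (h.related_of_mem hp' hn hzp' t)
  have hcard := h.card_filter n hn y hyn (near_of_adj hxy.symm hxn)
  obtain ⟨w, hw, hwx⟩ := Finset.exists_mem_ne (h.two_le.trans_eq hcard.symm :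
    1 < (n.filter (G.Adj y)).card) x
  rw [Finset.mem_filter] at hw
  obtain ⟨hwn, hyw⟩ := hw
  have hzw : G.Adj z w := by
    by_contra hzw
    exact hpn (h.related p hp n hn z hzp w hwn (fun t => hzn (t ▸ hwn)) hzw
      (near_of_adj hxz.symm hxn) (near_of_adj hyw.symm hyp))
  have hzw' : G.Adj z' w := by
    by_contra hzw
    exact hp'n (h.related p' hp' n hn z' hzp' w hwn (fun t => hzn' (t ▸ hwn)) hzw
      (near_of_adj hxz'.symm hxn) (near_of_adj hyw.symm hyp'))
  obtain ⟨q, hq, hzq, hwq⟩ := h.exists_line z w hzw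
  have hqm' : Related G q m' := h.related q hq m' hm' z hzq z' hzm' hne hzz'
    (near_of_adj hxz.symm hxm') (near_of_adj hzw' hwq)
  have hxq : x ∉ q := fun t =>
    hzn (h.eq_of_mem q hq n hn x w hwx.symm t hwq hxn hwn ▸ hzq)
  exact hpn (h.related_of_related hm' hn hm hq hp hxm' hxn hxm hxq hmm' hzm hzq hzp hqm'
    (h.related_of_mem hq hn hwq hwn) hpm')

end IsLineSystem
end GeometricDRG

namespace GeometricDRG

variable {V : Type*} [Fintype V] {G : SimpleGraph V} [DecidableRel G.Adj]

/-- The matrices whose entries depend only on the distance are closed under multiplication by the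
adjacency matrix. -/
lemma exists_adjMatrix_mul (hG : IsDistanceRegular G) {k : ℕ} (hk : G.IsRegularOfDegree k)
    (M : Matrix V V ℝ) (g : ℕ → ℝ) (hM : ∀ x y, M x y = g (G.dist x y)) :
    ∃ g' : ℕ → ℝ, ∀ x y, (G.adjMatrix ℝ * M) x y = g' (G.dist x y) := by
  obtain ⟨hconn, b, c, hbc⟩ := hG
  refine ⟨fun i => c i * (g (i - 1) - g i) + b i * (g (i + 1) - g i) + k * g i, fun y x => ?_⟩
  rw [SimpleGraph.adjMatrix_mul_apply]
  obtain ⟨hc, hb⟩ := hbc x y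
  have key : ∀ z ∈ G.neighborFinset y, M z x =
      (if G.dist x z + 1 = G.dist x y then g (G.dist x y - 1) - g (G.dist x y) else 0) +
      (if G.dist x z = G.dist x y + 1 then g (G.dist x y + 1) - g (G.dist x y) else 0) +
      g (G.dist x y) := by
    intro z hz
    rw [SimpleGraph.mem_neighborFinset] at hz
    rw [hM, SimpleGraph.dist_comm]
    have h1 := hconn.dist_triangle (u := x) (v := y) (w := z)
    have h2 := hconn.dist_triangle (u := x) (v := z) (w := y)
    rw [SimpleGraph.dist_eq_one_iff_adj.2 hz] at h1
    rw [SimpleGraph.dist_eq_one_iff_adj.2 hz.symm] at h2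
    rcases (by omega : G.dist x z + 1 = G.dist x y ∨ G.dist x z = G.dist x y ∨
      G.dist x z = G.dist x y + 1) with h | h | h
    · rw [if_pos h, if_neg (by omega), ← h]; simp
    · rw [if_neg (by omega), if_neg (by omega), h]; simp
    · rw [if_neg (by omega), if_pos h, h]; simp
  rw [Finset.sum_congr rfl key, Finset.sum_add_distrib, Finset.sum_add_distrib,
    ← Finset.sum_filter, ← Finset.sum_filter, Finset.sum_const, Finset.sum_const, Finset.sum_const,
    G.card_neighborFinset_eq_degree, hk.degree_eq, G.dist_comm (u := y)]
  dsimp only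
  rw [← hc, ← hb, Set.ncard_eq_toFinset_card', Set.ncard_eq_toFinset_card']
  simp only [nsmul_eq_mul]
  congr 4
  · congr 1; ext z; simp
  · congr 1; ext z; simp

variable [DecidableEq V]

lemma exists_aeval_adjMatrix (hG : IsDistanceRegular G) {k : ℕ} (hk : G.IsRegularOfDegree k)
    (p : Polynomial ℝ) :
    ∃ g : ℕ → ℝ, ∀ x y, Polynomial.aeval (G.adjMatrix ℝ) p x y = g (G.dist x y) := by
  induction p using Polynomial.induction_on with
  | C a =>
    refine ⟨fun i => if i = 0 then a else 0, fun x y => ?_⟩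
    simp [Matrix.algebraMap_matrix_apply, hG.1.dist_eq_zero_iff]
  | add p q hp hq =>
    obtain ⟨g, hg⟩ := hp
    obtain ⟨g', hg'⟩ := hq
    exact ⟨fun i => g i + g' i, fun x y => by simp [hg, hg']⟩
  | monomial n a h =>
    obtain ⟨g, hg⟩ := h
    obtain ⟨g', hg'⟩ := exists_adjMatrix_mul hG hk _ g hg
    refine ⟨g', fun x y => ?_⟩
    rw [← hg', pow_succ, ← mul_assoc, mul_comm _ Polynomial.X, map_mul, Polynomial.aeval_X]

/-- An eigenvalue `θ` of a distance-regular graph has a nonzero matrix of eigenvectors, idempotent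
up to a scalar, whose entries depend only on the distance. -/
lemma exists_distance_matrix (hG : IsDistanceRegular G) {k : ℕ} (hk : G.IsRegularOfDegree k)
    {θ : ℝ} (hθ : Module.End.HasEigenvalue (Matrix.toLin' (G.adjMatrix ℝ)) θ) :
    ∃ (M : Matrix V V ℝ) (g : ℕ → ℝ) (c : ℝ), (∀ x y, M x y = g (G.dist x y)) ∧
      G.adjMatrix ℝ * M = θ • M ∧ M * M = c • M ∧ M ≠ 0 := by
  have hroot := Module.End.isRoot_of_hasEigenvalue hθ
  rw [Matrix.minpoly_toLin'] at hroot
  obtain ⟨p, hp⟩ := Polynomial.dvd_iff_isRoot.2 hroot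
  have hint : IsIntegral ℝ (G.adjMatrix ℝ) := Algebra.IsIntegral.isIntegral _
  have hmin := minpoly.ne_zero hint
  have hp0 : p ≠ 0 := by
    rintro rfl
    exact hmin (by simpa using hp)
  obtain ⟨g, hg⟩ := exists_aeval_adjMatrix hG hk p
  have hAM : G.adjMatrix ℝ * Polynomial.aeval (G.adjMatrix ℝ) p =
      θ • Polynomial.aeval (G.adjMatrix ℝ) p := by
    have h := minpoly.aeval ℝ (G.adjMatrix ℝ)
    rw [hp, map_mul, map_sub, Polynomial.aeval_X, Polynomial.aeval_C, sub_mul, sub_eq_zero] at h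
    rw [h, Algebra.algebraMap_eq_smul_one, smul_mul_assoc, one_mul]
  refine ⟨_, g, p.eval θ, hg, hAM, ?_, fun h => ?_⟩
  · have : ∀ q : Polynomial ℝ, Polynomial.aeval (G.adjMatrix ℝ) q *
        Polynomial.aeval (G.adjMatrix ℝ) p = q.eval θ • Polynomial.aeval (G.adjMatrix ℝ) p := by
      intro q
      induction q using Polynomial.induction_on with
      | C a => rw [Polynomial.aeval_C, Algebra.algebraMap_eq_smul_one, smul_mul_assoc, one_mul,
          Polynomial.eval_C]
      | add q r hq hr => rw [map_add, add_mul, hq, hr, Polynomial.eval_add, add_smul]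
      | monomial n a h =>
        rw [pow_succ, ← mul_assoc, map_mul _ _ Polynomial.X, Polynomial.aeval_X, mul_assoc, hAM,
          mul_smul_comm, h, smul_smul, Polynomial.eval_mul_X, mul_comm]
    exact this p
  · have hle := minpoly.degree_le_of_ne_zero ℝ _ hp0 h
    rw [hp, Polynomial.degree_mul, Polynomial.degree_X_sub_C,
      Polynomial.degree_eq_natDegree hp0] at hle
    norm_cast at hle
    omega

/-- The common value `g i` at distance `i` sums to zero over a Delsarte clique. -/
lemma exists_sum_eq_zero [Nonempty V] (hG : IsDistanceRegular G) {k : ℕ}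
    (hk : G.IsRegularOfDegree k) (hθ : smallestEigenvalue G ≠ 0) :
    ∃ g : ℕ → ℝ, g 0 ≠ 0 ∧ (k : ℝ) * g 1 = smallestEigenvalue G * g 0 ∧
      ∀ C, IsDelsarteClique G C → ∀ x, ∑ y ∈ C, g (G.dist x y) = 0 := by
  have hmem : smallestEigenvalue G ∈
      {θ : ℝ | Module.End.HasEigenvalue (Matrix.toLin' (G.adjMatrix ℝ)) θ} := by
    refine Set.Nonempty.csInf_mem ⟨(k : ℝ), ?_⟩ (Module.End.finite_hasEigenvalue _)
    refine Module.End.hasEigenvalue_of_hasEigenvector (x := Function.const V 1) ⟨?_, ?_⟩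
    · rw [Module.End.mem_eigenspace_iff]
      ext v
      rw [Matrix.toLin'_apply, SimpleGraph.adjMatrix_mulVec_const_apply_of_regular hk]
      simp
    · exact fun h => one_ne_zero (congrFun h (Classical.arbitrary V))
  obtain ⟨M, g, c, hM, hAM, hMM, hM0⟩ := exists_distance_matrix hG hk hmem
  have hsymm : ∀ x y, M x y = M y x := fun x y => by rw [hM, hM, SimpleGraph.dist_comm]
  have h1 : (k : ℝ) * g 1 = smallestEigenvalue G * g 0 := by
    let x := Classical.arbitrary V
    have h := congrFun (congrFun hAM x) x
    rw [SimpleGraph.adjMatrix_mul_apply, Matrix.smul_apply, hM x x, SimpleGraph.dist_self,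
      smul_eq_mul] at h
    rw [← h, Finset.sum_congr rfl (g := fun _ => g 1), Finset.sum_const,
      G.card_neighborFinset_eq_degree, hk.degree_eq, nsmul_eq_mul]
    intro z hz
    rw [SimpleGraph.mem_neighborFinset] at hz
    rw [hM, SimpleGraph.dist_eq_one_iff_adj.2 hz.symm]
  refine ⟨g, fun h0 => hM0 ?_, h1, fun C hC x => ?_⟩
  · ext x y
    have h := congrFun (congrFun hMM x) x
    rw [Matrix.mul_apply, Matrix.smul_apply, hM x x, SimpleGraph.dist_self, h0, smul_zero,
      Finset.sum_congr rfl (fun z _ => by rw [hsymm z x]),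
      Finset.sum_eq_zero_iff_of_nonneg (fun z _ => mul_self_nonneg _)] at h
    exact mul_self_eq_zero.1 (h y (Finset.mem_univ y))
  · obtain ⟨hcl, k', hk', hcard⟩ := hC
    obtain rfl : k' = k := by
      rw [← hk'.degree_eq (Classical.arbitrary V), hk.degree_eq]
    have hrow : ∀ y ∈ C, ∑ y' ∈ C, M y y' = 0 := by
      intro y hy
      rw [← Finset.add_sum_erase C _ hy, hM, SimpleGraph.dist_self,
        Finset.sum_congr rfl (g := fun _ => g 1), Finset.sum_const, Finset.card_erase_of_mem hy,
        nsmul_eq_mul, Nat.cast_sub (Finset.card_pos.2 ⟨y, hy⟩), hcard]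
      · have : smallestEigenvalue G * (g 0 + (1 + (k' : ℝ) / -smallestEigenvalue G - (1 : ℕ)) * g 1)
            = smallestEigenvalue G * g 0 - k' * g 1 := by
          field_simp
          push_cast
          ring
        rw [h1, sub_self] at this
        exact (mul_eq_zero.1 this).resolve_left hθ
      · intro z hz
        rw [Finset.mem_erase] at hz
        rw [hM, SimpleGraph.dist_eq_one_iff_adj.2 (hcl hy hz.2 hz.1.symm)]
    have hsq : ∑ x, (∑ y ∈ C, M x y) * (∑ y ∈ C, M x y) = 0 := by
      calc ∑ x, (∑ y ∈ C, M x y) * (∑ y ∈ C, M x y)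
          = ∑ x, ∑ y ∈ C, ∑ y' ∈ C, M y x * M x y' := by
            refine Finset.sum_congr rfl fun x _ => ?_
            rw [Finset.sum_mul_sum]
            simp only [hsymm x]
        _ = ∑ y ∈ C, ∑ y' ∈ C, (M * M) y y' := by
            rw [Finset.sum_comm]
            refine Finset.sum_congr rfl fun y _ => ?_
            rw [Finset.sum_comm]
            simp only [Matrix.mul_apply]
        _ = ∑ y ∈ C, c * ∑ y' ∈ C, M y y' := by
            simp only [hMM, Matrix.smul_apply, smul_eq_mul, Finset.mul_sum]
        _ = 0 := Finset.sum_eq_zero fun y hy => by rw [hrow y hy, mul_zero]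
    rw [Finset.sum_eq_zero_iff_of_nonneg (fun z _ => mul_self_nonneg _)] at hsq
    have := mul_self_eq_zero.1 (hsq x (Finset.mem_univ x))
    simpa only [hM] using this

end GeometricDRG

namespace GeometricDRG

section

variable {V : Type*} {G : SimpleGraph V} {𝒞 : Set (Finset V)} {l m : Finset V} {a b p x y : V}

lemma dist_eq_two (hG : G.Connected) (hxy : x ≠ y) (hadj : ¬ G.Adj x y) (hxp : G.Adj x p)
    (hpy : G.Adj p y) : G.dist x y = 2 := by
  have h1 := hG.one_lt_dist_of_ne_of_not_adj hxy hadj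
  have h2 := hG.dist_triangle (u := x) (v := p) (w := y)
  rw [SimpleGraph.dist_eq_one_iff_adj.2 hxp, SimpleGraph.dist_eq_one_iff_adj.2 hpy] at h2
  omega

lemma exists_adj_of_dist_eq_succ (hG : G.Connected) {n : ℕ} (h : G.dist a b = n + 1) :
    ∃ c, G.dist a c = n ∧ G.Adj c b := by
  obtain ⟨w, hw⟩ := hG.exists_walk_length_eq_dist b a
  cases w with
  | nil => simp at h
  | @cons _ c _ hbc w =>
    refine ⟨c, ?_, hbc.symm⟩
    have h1 := SimpleGraph.dist_le w
    have h2 := hG.dist_triangle (u := a) (v := c) (w := b)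
    rw [SimpleGraph.dist_eq_one_iff_adj.2 hbc.symm] at h2
    rw [SimpleGraph.Walk.length_cons, G.dist_comm] at hw
    rw [G.dist_comm] at h1
    omega

lemma exists_dist_eq_of_le (hG : G.Connected) {n k : ℕ} (h : G.dist a b = n) (hk : k ≤ n) :
    ∃ c, G.dist a c = k := by
  induction n generalizing b with
  | zero => exact ⟨b, by omega⟩
  | succ n ih =>
    rcases hk.eq_or_lt with rfl | hlt
    · exact ⟨b, h⟩
    · obtain ⟨c, hc, -⟩ := exists_adj_of_dist_eq_succ hG h
      exact ih hc (by omega)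

lemma near_iff_exists_adj (ha : a ∉ l) : Near G a l ↔ ∃ p ∈ l, G.Adj a p :=
  ⟨fun ⟨p, hp, h⟩ => ⟨p, hp, h.resolve_left fun t => ha (t ▸ hp)⟩,
    fun ⟨_, hp, h⟩ => near_of_adj h hp⟩

lemma near_of_distTo_eq_one (h : distTo G a l = 1) : Near G a l := by
  obtain ⟨p, hp, hap⟩ := Nat.sInf_mem (Nat.nonempty_of_sInf_eq_succ h)
  refine near_of_adj (SimpleGraph.dist_eq_one_iff_adj.1 (hap.trans h)) hp

lemma notMem_of_distTo_eq_one (h : distTo G a l = 1) : a ∉ l := by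
  intro ha
  have : distTo G a l ≤ 0 := Nat.sInf_le ⟨a, ha, SimpleGraph.dist_self⟩
  omega

lemma distTo_eq_one (hG : G.Connected) (ha : a ∉ l) (h : Near G a l) : distTo G a l = 1 := by
  obtain ⟨p, hp, hap⟩ := (near_iff_exists_adj ha).1 h
  have h1 : distTo G a l ≤ 1 := Nat.sInf_le ⟨p, hp, SimpleGraph.dist_eq_one_iff_adj.2 hap⟩
  obtain ⟨q, hq, haq⟩ := Nat.sInf_mem (s := G.dist a '' (l : Set V)) ⟨_, p, hp, rfl⟩
  have h2 := hG.pos_dist_of_ne (u := a) (v := q) fun t => ha (t ▸ hq)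
  rw [haq] at h2
  exact le_antisymm h1 h2

/-- The equal line set property, in terms of vertices near a line. -/
lemma EqualLineSet.near (hE : EqualLineSet G 𝒞) (hG : G.Connected)
    (hcl : ∀ l ∈ 𝒞, G.IsClique (l : Set V)) (hl : l ∈ 𝒞) (hm : m ∈ 𝒞) (hx : x ∈ l) (hy : y ∈ m)
    (hxy : x ≠ y) (hadj : ¬ G.Adj x y) (hxm : Near G x m) (hyl : Near G y l) (ha : a ∈ m) :
    Near G a l := by
  have hxm' : x ∉ m := fun t => hadj (hcl m hm t hy hxy)
  have hyl' : y ∉ l := fun t => hadj (hcl l hl hx t hxy)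
  by_cases hax : a = x
  · exact near_of_mem (hax ▸ hx)
  by_cases hadjax : G.Adj a x
  · exact near_of_adj hadjax hx
  by_cases hay : a = y
  · exact hay ▸ hyl
  obtain ⟨p, hp, hxp⟩ := (near_iff_exists_adj hxm').1 hxm
  have h1 : G.dist x y = 2 := dist_eq_two hG hxy hadj hxp
    (hcl m hm hp hy fun t => hadj (t ▸ hxp))
  have h2 : G.dist x a = 2 := dist_eq_two hG (Ne.symm hax) (fun t => hadjax t.symm) hxp
    (hcl m hm hp ha fun t => hadjax (t ▸ hxp.symm))
  have h3 := hE x m hm (distTo_eq_one hG hxm' hxm) y hy a ha (Ne.symm hay) h1 h2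
  have h4 : l ∈ linesBetween G 𝒞 x y := ⟨hl, hx, distTo_eq_one hG hyl' hyl⟩
  rw [h3] at h4
  exact near_of_distTo_eq_one h4.2.2

lemma EqualLineSet.related (hE : EqualLineSet G 𝒞) (hG : G.Connected)
    (hcl : ∀ l ∈ 𝒞, G.IsClique (l : Set V)) (hl : l ∈ 𝒞) (hm : m ∈ 𝒞) (hx : x ∈ l) (hy : y ∈ m)
    (hxy : x ≠ y) (hadj : ¬ G.Adj x y) (hxm : Near G x m) (hyl : Near G y l) : Related G l m :=
  ⟨fun _ ha => hE.near hG hcl hm hl hy hx hxy.symm (fun t => hadj t.symm) hyl hxm ha,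
    fun _ ha => hE.near hG hcl hl hm hx hy hxy hadj hxm hyl ha⟩

/-- In a distance-regular graph of diameter at least `3`, every pair of vertices at distance `2`
extends to a pair at distance `3`. -/
lemma IsDistanceRegular.exists_dist_eq_three [Finite V] (hG : IsDistanceRegular G)
    (h : ∃ u v, G.dist u v = 3) (hxy : G.dist x y = 2) : ∃ z, G.Adj y z ∧ G.dist x z = 3 := by
  obtain ⟨hconn, b, c, hbc⟩ := hG
  obtain ⟨u, v, huv⟩ := h
  obtain ⟨w, huw, hwv⟩ := exists_adj_of_dist_eq_succ hconn huv
  have h1 := (hbc u w).2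
  have h2 := (hbc x y).2
  rw [huw] at h1
  rw [hxy, ← h1] at h2
  have h3 : {z | G.Adj w z ∧ G.dist u z = 2 + 1}.ncard ≠ 0 :=
    Set.ncard_ne_zero_of_mem (a := v) ⟨hwv, huv⟩
  rw [← h2] at h3
  exact Set.nonempty_of_ncard_ne_zero h3

end

section

variable {V : Type*} [Fintype V] [DecidableEq V] {G : SimpleGraph V} [DecidableRel G.Adj]
  {𝒞 : Set (Finset V)}

/-- The number of neighbours on a Delsarte clique of a vertex at distance one is constant. -/
lemma card_filter_adj_eq (hG : IsDistanceRegular G) (hθ : smallestEigenvalue G ≠ 0)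
    {C C' : Finset V} {x x' : V}
    (hC : IsDelsarteClique G C) (hC' : IsDelsarteClique G C') (hx : x ∉ C) (hx' : x' ∉ C')
    (hxC : Near G x C) (hxC' : Near G x' C') :
    (C.filter (G.Adj x)).card = (C'.filter (G.Adj x')).card := by
  have : Nonempty V := ⟨x⟩
  obtain ⟨k, hk, hcard⟩ := hC.2
  obtain ⟨k', hk', hcard'⟩ := hC'.2
  obtain rfl : k' = k := by rw [← hk'.degree_eq x, hk.degree_eq]
  obtain ⟨g, hg0, hg1, hg⟩ := exists_sum_eq_zero hG hk hθ
  have key : ∀ C x, IsDelsarteClique G C → x ∉ C → Near G x C →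
      ((C.filter (G.Adj x)).card : ℝ) * (g 1 - g 2) + C.card * g 2 = 0 := by
    intro C x hC hx hxC
    obtain ⟨p, hp, hxp⟩ := (near_iff_exists_adj hx).1 hxC
    rw [← hg C hC x, Finset.sum_congr rfl
      (g := fun y => (if G.Adj x y then g 1 - g 2 else 0) + g 2), Finset.sum_add_distrib,
      ← Finset.sum_filter, Finset.sum_const, Finset.sum_const, nsmul_eq_mul, nsmul_eq_mul]
    intro y hy
    by_cases h : G.Adj x y
    · rw [if_pos h, SimpleGraph.dist_eq_one_iff_adj.2 h, sub_add_cancel]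
    · have hne : x ≠ y := fun t => hx (t ▸ hy)
      rw [if_neg h, dist_eq_two hG.1 hne h hxp
        (hC.1 hp hy fun t => h (t ▸ hxp)), zero_add]
  have h1 := key C x hC hx hxC
  have h2 := key C' x' hC' hx' hxC'
  rw [hcard', ← hcard] at h2
  by_contra hne
  have h12 : g 1 - g 2 = 0 := by
    have h3 : (((C.filter (G.Adj x)).card : ℝ) - (C'.filter (G.Adj x')).card) * (g 1 - g 2) = 0 := by
      linear_combination h1 - h2
    refine (mul_eq_zero.1 h3).resolve_left fun t => hne ?_
    exact_mod_cast sub_eq_zero.1 t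
  rw [h12, mul_zero, zero_add] at h1
  obtain ⟨p, hp, -⟩ := hxC
  have hCpos : (C.card : ℝ) ≠ 0 := by exact_mod_cast (Finset.card_pos.2 ⟨p, hp⟩).ne'
  have hg2 := (mul_eq_zero.1 h1).resolve_left hCpos
  rw [hg2, sub_zero] at h12
  rw [h12, mul_zero] at hg1
  exact (mul_ne_zero hθ hg0) hg1.symm

theorem IsGeometric.isLineSystem (hG : IsGeometric G 𝒞) (hD : 3 ≤ G.diam) (hφ : 2 ≤ phi G 1)
    (hE : EqualLineSet G 𝒞) : ∃ φ, IsLineSystem G 𝒞 φ := by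
  obtain ⟨hdr, hdel, huniq⟩ := hG
  have hconn := hdr.1
  have hne : Nonempty V := hconn.nonempty
  have h3 : ∃ u v, G.dist u v = 3 := by
    obtain ⟨u, v, huv⟩ := G.exists_dist_eq_diam
    obtain ⟨c, hc⟩ := exists_dist_eq_of_le hconn huv hD
    exact ⟨u, c, hc⟩
  have hcl : ∀ l ∈ 𝒞, G.IsClique (l : Set V) := fun l hl => (hdel l hl).1
  have hex : ∀ x y, G.Adj x y → ∃ l ∈ 𝒞, x ∈ l ∧ y ∈ l := fun x y hxy =>
    (huniq x y hxy).exists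
  have hθ : smallestEigenvalue G ≠ 0 := by
    intro h0
    obtain ⟨u, v, huv⟩ := h3
    obtain ⟨w, -, hwv⟩ := exists_adj_of_dist_eq_succ hconn huv
    obtain ⟨l, hl, hwl, hvl⟩ := hex w v hwv
    obtain ⟨k, -, hk⟩ := (hdel l hl).2
    rw [h0, neg_zero, div_zero, add_zero] at hk
    have h1 : 1 < l.card := Finset.one_lt_card.2 ⟨w, hwl, v, hvl, hwv.ne⟩
    have h2 : l.card = 1 := by exact_mod_cast hk
    omega
  obtain ⟨C, x₀, hC, hx₀C, hphi⟩ := Nat.sSup_mem (s := {n : ℕ | ∃ (C : Finset V) (x : V),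
      IsDelsarteClique G C ∧ distTo G x C = 1 ∧ n = {y | y ∈ C ∧ G.dist x y = 1}.ncard})
    (Set.nonempty_iff_ne_empty.2 fun t => by
      rw [phi, t, csSup_empty] at hφ
      exact absurd hφ (by decide))
    ⟨Fintype.card V, by
      rintro n ⟨C, x, -, -, rfl⟩
      exact (Set.ncard_le_card _).trans_eq Nat.card_eq_fintype_card⟩
  have hφ' : 2 ≤ (C.filter (G.Adj x₀)).card := by
    rw [phi, hphi] at hφ
    convert hφ using 1
    rw [← Set.ncard_coe_finset]
    congr 1
    ext y
    simp
  have hcard : ∀ l ∈ 𝒞, ∀ x ∉ l, Near G x l →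
      (l.filter (G.Adj x)).card = (C.filter (G.Adj x₀)).card := fun l hl x hx hxl =>
    card_filter_adj_eq hdr hθ (hdel l hl) hC hx (notMem_of_distTo_eq_one hx₀C) hxl
      (near_of_distTo_eq_one hx₀C)
  refine ⟨(C.filter (G.Adj x₀)).card, hcl, hex, ?_, hcard, hφ', ?_, ?_, ?_⟩
  · intro l hl m hm x y hxy hxl hyl hxm hym
    exact (huniq x y (hcl l hl hxl hyl hxy)).unique ⟨hl, hxl, hyl⟩ ⟨hm, hxm, hym⟩
  · obtain ⟨x, w, hxw⟩ := h3
    obtain ⟨b, hxb, hbw⟩ := exists_adj_of_dist_eq_succ hconn hxw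
    obtain ⟨a, hxa, hab⟩ := exists_adj_of_dist_eq_succ hconn hxb
    rw [SimpleGraph.dist_eq_one_iff_adj] at hxa
    obtain ⟨q, hq, haq, hbq⟩ := hex a b hab
    have hxq : x ∉ q := fun t => by
      by_cases h : x = b
      · rw [h, SimpleGraph.dist_self] at hxb
        omega
      · rw [SimpleGraph.dist_eq_one_iff_adj.2 (hcl q hq t hbq h)] at hxb
        omega
    have haw : ∀ v, G.Adj x v → ¬ G.Adj w v := fun v h1 h2 => by
      have := hconn.dist_triangle (u := x) (v := v) (w := w)
      rw [SimpleGraph.dist_eq_one_iff_adj.2 h1, SimpleGraph.dist_eq_one_iff_adj.2 h2.symm] at this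
      omega
    have hwq : w ∉ q := fun t => by
      by_cases h : w = a
      · rw [h, SimpleGraph.dist_eq_one_iff_adj.2 hxa] at hxw
        omega
      · exact haw a hxa (hcl q hq t haq h)
    intro l hl
    have hlq : l.card = q.card := by
      obtain ⟨k, hk, h1⟩ := (hdel l hl).2
      obtain ⟨k', hk', h2⟩ := (hdel q hq).2
      rw [← hk.degree_eq x] at h1
      rw [← hk'.degree_eq x, ← h1] at h2
      exact_mod_cast h2.symm
    have h1 := hcard q hq x hxq (near_of_adj hxa haq)
    have h2 := hcard q hq w hwq (near_of_adj hbw.symm hbq)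
    rw [hlq, two_mul]
    nth_rewrite 1 [← h1]
    rw [← h2, ← Finset.card_union_of_disjoint]
    · exact Finset.card_le_card
        (Finset.union_subset (Finset.filter_subset _ _) (Finset.filter_subset _ _))
    · rw [Finset.disjoint_filter]
      exact fun v _ => haw v
  · intro l hl m hm x hx y hy hxy hadj hxm hyl
    exact hE.related hconn hcl hl hm hx hy hxy hadj hxm hyl
  · rintro x u hxu hadj ⟨p, hxp, hpu⟩
    have h2 : G.dist u x = 2 :=
      dist_eq_two hconn hxu.symm (fun t => hadj t.symm) hpu.symm hxp.symm
    obtain ⟨z, hxz, huz⟩ := hdr.exists_dist_eq_three h3 h2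
    obtain ⟨n, hn, hxn, hzn⟩ := hex x z hxz
    refine ⟨n, hn, hxn, ?_⟩
    rintro ⟨q, hqn, huq⟩
    have h4 : G.dist u q ≤ 1 := by
      rcases huq with rfl | h
      · simp
      · exact (SimpleGraph.dist_eq_one_iff_adj.2 h).le
    have h5 : G.dist q z ≤ 1 := by
      by_cases h : q = z
      · simp [h]
      · exact (SimpleGraph.dist_eq_one_iff_adj.2 (hcl n hn hqn hzn h)).le
    have := hconn.dist_triangle (u := u) (v := q) (w := z)
    omega

end

end GeometricDRG

theorem mainTheorem8 {V : Type*} [Fintype V] [DecidableEq V]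
    (G : SimpleGraph V) [DecidableRel G.Adj] (𝒞 : Set (Finset V))
    (hG : GeometricDRG.IsGeometric G 𝒞)
    (hD : 3 ≤ G.diam)
    (hφ : 2 ≤ GeometricDRG.phi G 1)
    (hELS : GeometricDRG.EqualLineSet G 𝒞) :
    GeometricDRG.DualPasch G 𝒞 := by
  obtain ⟨φ, h⟩ := hG.isLineSystem hD hφ hELS
  exact h.dualPasch
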